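/- Let $G=(V,E)$ be a finite graph (loops and multiple edges allowed) with total orders on $V$ and on $E$. For $S\subseteq E$ let $[G:S]$ be the spanning subgraph with edge set $S$ and let $k([G:S])$ be the number of its connected components. The graphic matroid $M(G)$ is the matroid on $E$ with rank function $S\mapsto |V|-k([G:S])$. Let $\tilde N=\mathbb Z^V$, let $\tilde\rho(S)\subseteq\tilde N$ be the subgroup generated by the differences $v-v'$ of the endpoints of the edges in $S$, let $I_G\subseteq\tilde N$ be the subgroup generated by the least vertex of each connected component of $G$, and put $\rho(S)=(\tilde\rho(S)+I_G)/I_G$ and $N=\rho(E)=\tilde N/I_G$; this $\rho$ is the canonical $\mathbb Z$-quasi-representation of $M(G)$. Let $$C^{i,j}(M(G))=\bigoplus_{S\subseteq E,\ |S|=i}\ \bigwedge\nolimits^{j} N/\rho(S)$$ (zero if $i<0$ or $j<0$), with differential $C^{i,j}\to C^{i+1,j}$ the sum over $S$ and $e\in E\setminus S$ of $(-1)^{|\{e'\in S\,:\,e'<e\}|}$ times the map induced by the projection $N/\rho(S)\to N/\rho(S\cup e)$, and let $H^{i,j}(M(G))$ be the cohomology of this complex (the characteristic cohomology of $M(G)$).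 Let $n=|V|-k([G:E])+1=\operatorname{rank}M(G)+1$, which is the number of vertices of any connected graph $G'$ with $M(G')\cong M(G)$; in particular $n=|V|$ if $G$ is connected. Then for all integers $i,j$ with $i+j<n-1$ there is an isomorphism of abelian groups $$H^{i,j}(M(G))\cong H^{i+1,j-1}(M(G)).$$ -/

import Mathlib

open scoped BigOperators

noncomputable section

set_option linter.unusedSectionVars false

namespace CharCoh

universe u v w

/-- A matroid on the finite ground set `E`, given by its rank function. -/
structure RankMatroid (E : Type u) [DecidableEq E] where
  rk : Finset E → ℕ
  rk_le_card : ∀ S, rk S ≤ S.card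
  rk_mono : ∀ ⦃S T⦄, S ⊆ T → rk S ≤ rk T
  rk_submod : ∀ S T, rk (S ∩ T) + rk (S ∪ T) ≤ rk S + rk T

/-- An `R`-quasi-representation of the matroid `M` in the module `N`, for a principal ideal
domain `R`. For a module `P` over a domain, `Module.finrank R P` is the dimension of
`P ⊗ Frac R`. -/
structure QuasiRep (R : Type v) [CommRing R] [IsDomain R] [IsPrincipalIdealRing R]
    {E : Type u} [Fintype E] [DecidableEq E]
    (M : RankMatroid E) (N : Type w) [AddCommGroup N] [Module R N] [Module.Finite R N] where
  sub : Finset E → Submodule R N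
  finrank_sub : ∀ S, Module.finrank R (sub S) = M.rk S
  sub_empty : sub ∅ = ⊥
  sub_univ : sub Finset.univ = ⊤
  sub_mono : ∀ ⦃S T⦄, S ⊆ T → sub S ≤ sub T
  sub_eq : ∀ ⦃S T⦄, S ⊆ T → M.rk S = M.rk T → sub S = sub T

/-! ### Exterior powers with an integer exponent (zero for negative exponents) -/

section ExtPow

variable (R : Type v) [CommRing R]

/-- The `j`-th exterior power of `L`, as the degree `j` part of the exterior algebra;
it is zero for `j < 0`. -/
def extPow (L : Type w) [AddCommGroup L] [Module R L] :
    ℤ → Submodule R (ExteriorAlgebra R L)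
  | Int.ofNat k => ⋀[R]^k L
  | Int.negSucc _ => ⊥

variable {R} {L : Type*} {L' : Type*}
  [AddCommGroup L] [Module R L] [AddCommGroup L'] [Module R L']

lemma extPow_map_mem (f : L →ₗ[R] L') (j : ℤ) (x : ExteriorAlgebra R L)
    (hx : x ∈ extPow R L j) :
    (ExteriorAlgebra.map f).toLinearMap x ∈ extPow R L' j := by
  cases j with
  | ofNat k =>
    change x ∈ ⋀[R]^k L at hx
    change _ ∈ ⋀[R]^k L'
    have h : (⋀[R]^k L).map (ExteriorAlgebra.map f).toLinearMap ≤ ⋀[R]^k L' := by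
      rw [Submodule.map_pow]
      refine pow_le_pow_left' ?_ k
      rintro _ ⟨_, ⟨m, rfl⟩, rfl⟩
      exact ⟨f m, by simp⟩
    exact h ⟨x, hx, rfl⟩
  | negSucc k =>
    change x ∈ (⊥ : Submodule R _) at hx
    rw [Submodule.mem_bot] at hx
    subst hx
    simp

/-- The map induced on exterior powers by a linear map. -/
def extPowMap (f : L →ₗ[R] L') (j : ℤ) : extPow R L j →ₗ[R] extPow R L' j :=
  (ExteriorAlgebra.map f).toLinearMap.restrict (extPow_map_mem f j)

end ExtPow

/-! ### The cochain complex of a matroid with a quasi-representation -/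

section Complex

variable {R : Type v} [CommRing R] [IsDomain R] [IsPrincipalIdealRing R]
  {E : Type u} [Fintype E] [LinearOrder E]
  {M : RankMatroid E} {N : Type w} [AddCommGroup N] [Module R N] [Module.Finite R N]

/-- The sign `(-1) ^ #{e' ∈ S | e' < e}`. -/
def edgeSign (R : Type v) [CommRing R] (S : Finset E) (e : E) : R :=
  (-1) ^ (S.filter (· < e)).card

/-- The natural projection `N / ρ(S) → N / ρ(T)` for `S ⊆ T`. -/
def quotMap (ρ : QuasiRep R M N) {S T : Finset E} (h : S ⊆ T) :
    (N ⧸ ρ.sub S) →ₗ[R] (N ⧸ ρ.sub T) :=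
  Submodule.factor (ρ.sub_mono h)

/-- The chain group `C^{i,j}`: the direct sum of `⋀^j (N / ρ(S))` over all `S` with `i` elements
(a product over a finite index set). -/
def Cochain (ρ : QuasiRep R M N) (i j : ℤ) : Type (max u v w) :=
  (S : {S : Finset E // (S.card : ℤ) = i}) → extPow R (N ⧸ ρ.sub S.1) j

instance (ρ : QuasiRep R M N) (i j : ℤ) : AddCommGroup (Cochain ρ i j) :=
  inferInstanceAs (AddCommGroup
    ((S : {S : Finset E // (S.card : ℤ) = i}) → extPow R (N ⧸ ρ.sub S.1) j))

instance (ρ : QuasiRep R M N) (i j : ℤ) : Module R (Cochain ρ i j) :=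
  inferInstanceAs (Module R
    ((S : {S : Finset E // (S.card : ℤ) = i}) → extPow R (N ⧸ ρ.sub S.1) j))

/-- The component of a cochain at `S`. -/
def Cochain.component (ρ : QuasiRep R M N) (i j : ℤ) (S : {S : Finset E // (S.card : ℤ) = i}) :
    Cochain ρ i j →ₗ[R] extPow R (N ⧸ ρ.sub S.1) j :=
  LinearMap.proj S

lemma card_erase_of_card {T : Finset E} {i i' : ℤ} (h : i + 1 = i') (hT : (T.card : ℤ) = i')
    {e : E} (he : e ∈ T) : ((T.erase e).card : ℤ) = i := by
  have := Finset.card_erase_add_one he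
  omega

/-- The differential `C^{i,j} → C^{i',j}`, where `i' = i + 1`. Its component at `T` is the sum over
`e ∈ T` of the signed projections from the component at `T \ {e}`. -/
def d (ρ : QuasiRep R M N) (i i' j : ℤ) (h : i + 1 = i') :
    Cochain ρ i j →ₗ[R] Cochain ρ i' j :=
  LinearMap.pi fun T =>
    ∑ e : {e // e ∈ T.1},
      edgeSign R (T.1.erase e.1) e.1 •
        (extPowMap (quotMap ρ (Finset.erase_subset e.1 T.1)) j ∘ₗ
          Cochain.component ρ i j ⟨T.1.erase e.1, card_erase_of_card h T.2 e.2⟩)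

lemma d_apply_coe (ρ : QuasiRep R M N) (i i' j : ℤ) (h : i + 1 = i') (x : Cochain ρ i j)
    (T : {S : Finset E // (S.card : ℤ) = i'}) :
    ((d ρ i i' j h x) T).1 = ∑ e : {e // e ∈ T.1}, edgeSign R (T.1.erase e.1) e.1 •
      ExteriorAlgebra.map (quotMap ρ (Finset.erase_subset e.1 T.1))
        (x ⟨T.1.erase e.1, card_erase_of_card h T.2 e.2⟩).1 := by
  change ((∑ e : {e // e ∈ T.1}, edgeSign R (T.1.erase e.1) e.1 •
    (extPowMap (quotMap ρ (Finset.erase_subset e.1 T.1)) j ∘ₗ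
      Cochain.component ρ i j ⟨T.1.erase e.1, card_erase_of_card h T.2 e.2⟩))
        x : extPow R (N ⧸ ρ.sub T.1) j).1 = _
  rw [LinearMap.sum_apply, Submodule.coe_sum]
  rfl

/-- The characteristic cohomology `H^{i,j}(M, ρ)`: cocycles modulo coboundaries. -/
abbrev Cohomology (ρ : QuasiRep R M N) (i j : ℤ) : Type (max u v w) :=
  LinearMap.ker (d ρ i (i + 1) j rfl) ⧸
    (LinearMap.range (d ρ (i - 1) i j (sub_add_cancel i 1))).submoduleOf
      (LinearMap.ker (d ρ i (i + 1) j rfl))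

lemma edgeSign_anti (U : Finset E) {e f : E} (he : e ∈ U) (hf : f ∈ U) (hef : e ≠ f) :
    edgeSign R (U.erase e) e * edgeSign R ((U.erase e).erase f) f +
      edgeSign R (U.erase f) f * edgeSign R ((U.erase f).erase e) e = 0 := by
  wlog hlt : e < f generalizing e f
  · rw [add_comm]
    exact this hf he hef.symm (lt_of_le_of_ne (not_lt.1 hlt) hef.symm)
  have h1 : (U.erase e).filter (· < e) = ((U.erase f).erase e).filter (· < e) := by
    ext x
    simp only [Finset.mem_filter, Finset.mem_erase]
    constructor
    · rintro ⟨⟨h1, h2⟩, h3⟩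
      exact ⟨⟨h1, (h3.trans hlt).ne, h2⟩, h3⟩
    · rintro ⟨⟨h1, h2, h3⟩, h4⟩
      exact ⟨⟨h1, h3⟩, h4⟩
  have h2 : (U.erase f).filter (· < f) = insert e (((U.erase e).erase f).filter (· < f)) := by
    ext x
    simp only [Finset.mem_filter, Finset.mem_erase, Finset.mem_insert]
    constructor
    · rintro ⟨⟨h1, h2⟩, h3⟩
      by_cases hx : x = e
      · exact Or.inl hx
      · exact Or.inr ⟨⟨h1, hx, h2⟩, h3⟩
    · rintro (rfl | ⟨⟨h1, h2, h3⟩, h4⟩)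
      · exact ⟨⟨hef, he⟩, hlt⟩
      · exact ⟨⟨h1, h3⟩, h4⟩
  have h3 : e ∉ ((U.erase e).erase f).filter (· < f) := by simp
  unfold edgeSign
  rw [h1, h2, Finset.card_insert_of_notMem h3, pow_succ]
  ring

/-- The maps `d` form a complex. -/
lemma d_comp_d (ρ : QuasiRep R M N) (i i' i'' j : ℤ) (h : i + 1 = i') (h' : i' + 1 = i'') :
    d ρ i' i'' j h' ∘ₗ d ρ i i' j h = 0 := by
  classical
  apply LinearMap.ext
  intro x
  funext U
  apply Subtype.ext
  let X : Finset E → ExteriorAlgebra R (N ⧸ ρ.sub U.1) := fun S =>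
    if hS : (S.card : ℤ) = i ∧ S ⊆ U.1 then
      ExteriorAlgebra.map (quotMap ρ hS.2) (x ⟨S, hS.1⟩).1 else 0
  have key : (((d ρ i' i'' j h' ∘ₗ d ρ i i' j h) x) U).1 =
      ∑ e ∈ U.1, ∑ f ∈ U.1.erase e,
        (edgeSign R (U.1.erase e) e * edgeSign R ((U.1.erase e).erase f) f) •
          X ((U.1.erase e).erase f) := by
    rw [← Finset.sum_coe_sort U.1]
    rw [LinearMap.comp_apply, d_apply_coe]
    refine Finset.sum_congr rfl fun e _ => ?_
    rw [d_apply_coe, map_sum, Finset.smul_sum, ← Finset.sum_coe_sort (U.1.erase e)]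
    refine Finset.sum_congr rfl fun f _ => ?_
    have hS : ((((U.1.erase e).erase f.1).card : ℤ) = i ∧ (U.1.erase e).erase f.1 ⊆ U.1) :=
      ⟨card_erase_of_card h (card_erase_of_card h' U.2 e.2) f.2,
        (Finset.erase_subset _ _).trans (Finset.erase_subset _ _)⟩
    simp only [X, dif_pos hS, map_smul, smul_smul]
    congr 1
    change (ExteriorAlgebra.map _) ((ExteriorAlgebra.map _) _) = _
    rw [← AlgHom.comp_apply, ExteriorAlgebra.map_comp_map]
    congr 2
    ext n
    rfl
  rw [key, Finset.sum_sigma']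
  change _ = (0 : ExteriorAlgebra R _)
  refine Finset.sum_involution (fun p _ => ⟨p.2, p.1⟩) ?_ ?_ ?_ ?_
  · rintro ⟨e, f⟩ hp
    simp only [Finset.mem_sigma, Finset.mem_erase] at hp
    simp only
    rw [Finset.erase_right_comm (a := f) (b := e), ← add_smul]
    have := edgeSign_anti (R := R) U.1 hp.1 hp.2.2 (Ne.symm hp.2.1)
    rw [Finset.erase_right_comm (a := f) (b := e)] at this
    rw [this, zero_smul]
  · rintro ⟨e, f⟩ hp _ heq
    simp only [Finset.mem_sigma, Finset.mem_erase] at hp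
    simp only [Sigma.mk.injEq] at heq
    exact hp.2.1 heq.1
  · rintro ⟨e, f⟩ hp
    simp only [Finset.mem_sigma, Finset.mem_erase] at hp ⊢
    exact ⟨hp.2.2, Ne.symm hp.2.1, hp.1⟩
  · rintro ⟨e, f⟩ hp
    rfl

end Complex

/-! ### Graphic matroids and their canonical integral quasi-representation

Graphs are finite multigraphs: loops and parallel edges are allowed. -/

section Graphic

variable {α : Type u} {β : Type v} (G : Graph α β)

/-- Two vertices are adjacent here if they are distinct and joined by an edge in `S`. This simple
graph has the same connected components as the spanning subgraph `[G : S]`. -/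
def spanningGraph (S : Finset G.edgeSet) : SimpleGraph G.vertexSet :=
  SimpleGraph.fromRel fun x y => ∃ e ∈ S, G.IsLink e.1 x.1 y.1

/-- The set `Conn(S)` of connected components of the spanning subgraph `[G : S]`. -/
abbrev Conn (S : Finset G.edgeSet) : Type u := (spanningGraph G S).ConnectedComponent

/-- The number `k([G : S])` of connected components of the spanning subgraph `[G : S]`. -/
def numConn (S : Finset G.edgeSet) : ℕ := Nat.card (Conn G S)

/-- The rank function `|V| - k([G : S])` (there are at most `|V|` components). -/
def graphicRank (S : Finset G.edgeSet) : ℕ := Nat.card G.vertexSet - numConn G S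

/-- The submodule of `ℤ^V` spanned by the differences `x - y` of the ends of the edges in `S`. -/
def edgeSpan (S : Finset G.edgeSet) : Submodule ℤ (G.vertexSet →₀ ℤ) :=
  Submodule.span ℤ {w | ∃ e ∈ S, ∃ x y : G.vertexSet, G.IsLink e.1 x.1 y.1 ∧
    w = Finsupp.single x 1 - Finsupp.single y 1}

/-- The submodule `I_G` of `ℤ^V` spanned by the least vertices of the connected components of
`G`. -/
def rootSpan [Fintype G.edgeSet] [LinearOrder G.vertexSet] : Submodule ℤ (G.vertexSet →₀ ℤ) :=
  Submodule.span ℤ {w | ∃ F : Conn G Finset.univ, ∃ x : G.vertexSet, IsLeast F.supp x ∧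
    w = Finsupp.single x 1}

lemma numConn_le [Finite G.vertexSet] (S : Finset G.edgeSet) :
    numConn G S ≤ Nat.card G.vertexSet :=
  Nat.card_le_card_of_surjective (spanningGraph G S).connectedComponentMk Quot.mk_surjective

lemma graphicRank_add_numConn [Finite G.vertexSet] (S : Finset G.edgeSet) :
    graphicRank G S + numConn G S = Nat.card G.vertexSet :=
  Nat.sub_add_cancel (numConn_le G S)

/-- The map `ℤ^V → ℤ^Conn(S)` sending a vertex to its component. -/
def compMap (S : Finset G.edgeSet) : (G.vertexSet →₀ ℤ) →ₗ[ℤ] (Conn G S →₀ ℤ) :=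
  Finsupp.lmapDomain ℤ ℤ (spanningGraph G S).connectedComponentMk

lemma compMap_single (S : Finset G.edgeSet) (x : G.vertexSet) (a : ℤ) :
    compMap G S (Finsupp.single x a) =
      Finsupp.single ((spanningGraph G S).connectedComponentMk x) a := by
  simp [compMap]

lemma sub_mem_edgeSpan (S : Finset G.edgeSet) {x y : G.vertexSet}
    (h : (spanningGraph G S).Reachable x y) :
    Finsupp.single x (1 : ℤ) - Finsupp.single y 1 ∈ edgeSpan G S := by
  obtain ⟨p⟩ := h
  induction p with
  | nil => simp
  | cons hadj _ ih =>
    rw [← sub_add_sub_cancel]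
    refine add_mem ?_ ih
    rw [spanningGraph, SimpleGraph.fromRel_adj] at hadj
    obtain ⟨-, ⟨e, he, hl⟩ | ⟨e, he, hl⟩⟩ := hadj
    · exact Submodule.subset_span ⟨e, he, _, _, hl, rfl⟩
    · exact Submodule.subset_span ⟨e, he, _, _, hl.symm, rfl⟩

lemma edgeSpan_eq_ker (S : Finset G.edgeSet) : edgeSpan G S = LinearMap.ker (compMap G S) := by
  apply le_antisymm
  · refine Submodule.span_le.2 ?_
    rintro _ ⟨e, he, x, y, hl, rfl⟩
    have : (spanningGraph G S).Reachable x y := by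
      by_cases hxy : x = y
      · rw [hxy]
      · refine SimpleGraph.Adj.reachable ?_
        rw [spanningGraph, SimpleGraph.fromRel_adj]
        exact ⟨hxy, Or.inl ⟨e, he, hl⟩⟩
    rw [SetLike.mem_coe, LinearMap.mem_ker, map_sub, compMap_single, compMap_single,
      SimpleGraph.ConnectedComponent.eq.2 this, sub_self]
  · intro z hz
    let r : Conn G S → G.vertexSet := Quot.out
    have hr : ∀ x, (spanningGraph G S).Reachable x
        (r ((spanningGraph G S).connectedComponentMk x)) := fun x =>
      SimpleGraph.ConnectedComponent.eq.1 (Quot.out_eq _).symm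
    have h1 : ∀ z : G.vertexSet →₀ ℤ,
        z - Finsupp.lmapDomain ℤ ℤ r (compMap G S z) ∈ edgeSpan G S := by
      intro z
      induction z using Finsupp.induction_linear with
      | zero => simp
      | add a b ha hb =>
        have := add_mem ha hb
        rw [map_add, map_add]
        convert this using 1
        abel
      | single x a =>
        have := Submodule.smul_mem _ a (sub_mem_edgeSpan G S (hr x))
        rw [compMap_single]
        simpa [smul_sub] using this
    have := h1 z
    rw [LinearMap.mem_ker] at hz
    rwa [hz, map_zero, sub_zero] at this

lemma finrank_edgeSpan [Finite G.vertexSet] (S : Finset G.edgeSet) :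
    Module.finrank ℤ (edgeSpan G S) = graphicRank G S := by
  classical
  have := Fintype.ofFinite G.vertexSet
  have := Fintype.ofFinite (Conn G S)
  have h := (LinearMap.ker (compMap G S)).finrank_quotient_add_finrank
  have hs : Function.Surjective (compMap G S) :=
    Finsupp.mapDomain_surjective Quot.mk_surjective
  rw [((compMap G S).quotKerEquivOfSurjective hs).finrank_eq, Module.finrank_finsupp_self,
    Module.finrank_finsupp_self, ← edgeSpan_eq_ker] at h
  have h2 := graphicRank_add_numConn G S
  rw [numConn, Nat.card_eq_fintype_card, Nat.card_eq_fintype_card] at h2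
  omega

lemma edgeSpan_mono {S T : Finset G.edgeSet} (h : S ⊆ T) : edgeSpan G S ≤ edgeSpan G T :=
  Submodule.span_mono fun _ ⟨e, he, hx⟩ => ⟨e, h he, hx⟩

lemma edgeSpan_empty : edgeSpan G ∅ = ⊥ := by
  simp [edgeSpan]

lemma edgeSpan_union [DecidableEq G.edgeSet] (S T : Finset G.edgeSet) :
    edgeSpan G (S ∪ T) = edgeSpan G S ⊔ edgeSpan G T := by
  rw [edgeSpan, edgeSpan, edgeSpan, ← Submodule.span_union]
  congr 1
  ext w
  simp only [Finset.mem_union, Set.mem_union, Set.mem_ofPred_eq]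
  constructor
  · rintro ⟨e, he | he, h⟩
    · exact Or.inl ⟨e, he, h⟩
    · exact Or.inr ⟨e, he, h⟩
  · rintro (⟨e, he, h⟩ | ⟨e, he, h⟩)
    · exact ⟨e, Or.inl he, h⟩
    · exact ⟨e, Or.inr he, h⟩

lemma finrank_edgeSpan_le_card [Finite G.vertexSet] (S : Finset G.edgeSet) :
    Module.finrank ℤ (edgeSpan G S) ≤ S.card := by
  classical
  have hex : ∀ e : G.edgeSet, ∃ p : G.vertexSet × G.vertexSet, G.IsLink e.1 p.1.1 p.2.1 := by
    intro e
    obtain ⟨x, y, h⟩ := Graph.exists_isLink_of_mem_edgeSet e.2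
    exact ⟨⟨⟨x, h.left_mem⟩, ⟨y, h.right_mem⟩⟩, h⟩
  choose p hp using hex
  let f : G.edgeSet → (G.vertexSet →₀ ℤ) := fun e =>
    Finsupp.single (p e).1 1 - Finsupp.single (p e).2 1
  have : edgeSpan G S = Submodule.span ℤ ((S.image f : Finset _) : Set (G.vertexSet →₀ ℤ)) := by
    apply le_antisymm
    · refine Submodule.span_le.2 ?_
      rintro _ ⟨e, he, x, y, hl, rfl⟩
      have hf : f e ∈ Submodule.span ℤ ((S.image f : Finset _) : Set (G.vertexSet →₀ ℤ)) :=
        Submodule.subset_span (Finset.mem_coe.2 (Finset.mem_image_of_mem f he))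
      rcases hl.eq_and_eq_or_eq_and_eq (hp e) with ⟨h1, h2⟩ | ⟨h1, h2⟩
      · rw [Subtype.ext h1, Subtype.ext h2]
        exact hf
      · rw [Subtype.ext h1, Subtype.ext h2]
        have := neg_mem hf
        simpa [f] using this
    · refine Submodule.span_le.2 ?_
      intro w hw
      obtain ⟨e, he, rfl⟩ := Finset.mem_image.1 (Finset.mem_coe.1 hw)
      exact Submodule.subset_span ⟨e, he, _, _, hp e, rfl⟩
  rw [this]
  exact (finrank_span_finset_le_card _).trans Finset.card_image_le

/-- The graphic matroid `M(G)` of a finite graph `G`. -/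
def graphicMatroid [Finite G.vertexSet] [DecidableEq G.edgeSet] : RankMatroid G.edgeSet where
  rk := graphicRank G
  rk_le_card S := by
    rw [← finrank_edgeSpan]
    exact finrank_edgeSpan_le_card G S
  rk_mono S T h := by
    rw [← finrank_edgeSpan, ← finrank_edgeSpan]
    exact Submodule.finrank_mono (edgeSpan_mono G h)
  rk_submod S T := by
    have h1 := Submodule.rank_sup_add_rank_inf_eq (edgeSpan G S) (edgeSpan G T)
    rw [← edgeSpan_union] at h1
    simp only [← Module.finrank_eq_rank] at h1
    have h2 : Module.finrank ℤ (edgeSpan G (S ∩ T)) ≤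
        Module.finrank ℤ (edgeSpan G S ⊓ edgeSpan G T : Submodule ℤ (G.vertexSet →₀ ℤ)) :=
      Submodule.finrank_mono (le_inf (edgeSpan_mono G Finset.inter_subset_left)
        (edgeSpan_mono G Finset.inter_subset_right))
    have h3 := h1
    norm_cast at h3
    simp only [finrank_edgeSpan] at h2 h3
    omega

lemma edgeSpan_eq_of_rank_eq [Finite G.vertexSet] {S T : Finset G.edgeSet} (h : S ⊆ T)
    (hr : graphicRank G S = graphicRank G T) : edgeSpan G S = edgeSpan G T := by
  refine le_antisymm (edgeSpan_mono G h) ?_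
  have hle : spanningGraph G S ≤ spanningGraph G T := by
    intro x y hxy
    rw [spanningGraph, SimpleGraph.fromRel_adj] at hxy ⊢
    refine ⟨hxy.1, hxy.2.imp ?_ ?_⟩
    · rintro ⟨e, he, hl⟩
      exact ⟨e, h he, hl⟩
    · rintro ⟨e, he, hl⟩
      exact ⟨e, h he, hl⟩
  let g : Conn G S → Conn G T := SimpleGraph.ConnectedComponent.map (SimpleGraph.Hom.ofLE hle)
  have hg : ∀ x, g ((spanningGraph G S).connectedComponentMk x) =
      (spanningGraph G T).connectedComponentMk x := fun x => rfl
  have hsurj : Function.Surjective g := by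
    intro F
    induction F using SimpleGraph.ConnectedComponent.ind with
    | _ x => exact ⟨_, hg x⟩
  have hcard : Nat.card (Conn G S) = Nat.card (Conn G T) := by
    have h1 := graphicRank_add_numConn G S
    have h2 := graphicRank_add_numConn G T
    rw [numConn] at h1 h2
    omega
  have hinj : Function.Injective g :=
    ((Nat.bijective_iff_surjective_and_card g).2 ⟨hsurj, hcard⟩).1
  refine Submodule.span_le.2 ?_
  rintro _ ⟨e, he, x, y, hl, rfl⟩
  apply sub_mem_edgeSpan
  apply SimpleGraph.ConnectedComponent.eq.1
  apply hinj
  rw [hg, hg]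
  apply SimpleGraph.ConnectedComponent.eq.2
  by_cases hxy : x = y
  · rw [hxy]
  · refine SimpleGraph.Adj.reachable ?_
    rw [spanningGraph, SimpleGraph.fromRel_adj]
    exact ⟨hxy, Or.inl ⟨e, he, hl⟩⟩

lemma exists_isLeast [Finite G.vertexSet] [LinearOrder G.vertexSet] {S : Finset G.edgeSet}
    (F : Conn G S) : ∃ x, IsLeast F.supp x := by
  obtain ⟨x, hx, h⟩ := Set.exists_min_image F.supp id (Set.toFinite _) F.nonempty_supp
  exact ⟨x, hx, h⟩

lemma edgeSpan_inf_rootSpan [Finite G.vertexSet] [LinearOrder G.vertexSet] [Fintype G.edgeSet]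
    (S : Finset G.edgeSet) : edgeSpan G S ⊓ rootSpan G = ⊥ := by
  choose r hr using fun F : Conn G Finset.univ => exists_isLeast G F
  have hI : rootSpan G ≤ LinearMap.range (Finsupp.lmapDomain ℤ ℤ r) := by
    refine Submodule.span_le.2 ?_
    rintro _ ⟨F, x, hx, rfl⟩
    refine ⟨Finsupp.single F 1, ?_⟩
    rw [hx.unique (hr F)]
    simp
  have hsec : ∀ z, compMap G Finset.univ (Finsupp.lmapDomain ℤ ℤ r z) = z := by
    intro z
    rw [compMap, Finsupp.lmapDomain_apply, Finsupp.lmapDomain_apply, ← Finsupp.mapDomain_comp]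
    convert Finsupp.mapDomain_id
    funext F
    exact (hr F).1
  rw [eq_bot_iff]
  rintro y ⟨h1, h2⟩
  have h3 := edgeSpan_mono G (Finset.subset_univ S) h1
  rw [edgeSpan_eq_ker, LinearMap.mem_ker] at h3
  obtain ⟨z, rfl⟩ := hI h2
  rw [hsec] at h3
  rw [h3, map_zero]
  exact Submodule.zero_mem _

lemma edgeSpan_sup_rootSpan [Finite G.vertexSet] [LinearOrder G.vertexSet] [Fintype G.edgeSet] :
    edgeSpan G Finset.univ ⊔ rootSpan G = ⊤ := by
  refine (Submodule.eq_top_iff').2 fun z => ?_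
  induction z using Finsupp.induction_linear with
  | zero => exact Submodule.zero_mem _
  | add a b ha hb => exact add_mem ha hb
  | single x a =>
    obtain ⟨r, hr⟩ := exists_isLeast G ((spanningGraph G Finset.univ).connectedComponentMk x)
    have h1 : (spanningGraph G Finset.univ).Reachable x r :=
      SimpleGraph.ConnectedComponent.eq.1 hr.1.symm
    have h2 := Submodule.mem_sup_left (T := rootSpan G) (sub_mem_edgeSpan G Finset.univ h1)
    have h3 : Finsupp.single r (1 : ℤ) ∈ edgeSpan G Finset.univ ⊔ rootSpan G :=
      Submodule.mem_sup_right (Submodule.subset_span ⟨_, r, hr, rfl⟩)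
    have h4 := Submodule.smul_mem _ a (add_mem h2 h3)
    simpa using h4

/-- The canonical `ℤ`-quasi-representation of `M(G)`: the module is `N = ℤ^V / I_G`, and
`ρ(S)` is the image in `N` of the span of the differences of the ends of the edges in `S`. -/
def canonicalRep [Finite G.vertexSet] [LinearOrder G.vertexSet] [Fintype G.edgeSet]
    [DecidableEq G.edgeSet] :
    QuasiRep ℤ (graphicMatroid G) ((G.vertexSet →₀ ℤ) ⧸ rootSpan G) where
  sub S := (edgeSpan G S).map (rootSpan G).mkQ
  finrank_sub S := by
    change _ = graphicRank G S
    rw [← finrank_edgeSpan]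
    refine (LinearEquiv.finrank_eq (LinearEquiv.ofBijective
      ((rootSpan G).mkQ.submoduleMap (edgeSpan G S)) ⟨?_, LinearMap.submoduleMap_surjective _ _⟩)).symm
    rw [injective_iff_map_eq_zero]
    rintro ⟨x, hx⟩ h
    have h1 : (rootSpan G).mkQ x = 0 := congrArg Subtype.val h
    have h2 : x ∈ edgeSpan G S ⊓ rootSpan G :=
      ⟨hx, by simpa [Submodule.Quotient.mk_eq_zero] using h1⟩
    rw [edgeSpan_inf_rootSpan, Submodule.mem_bot] at h2
    exact Subtype.ext h2
  sub_empty := by rw [edgeSpan_empty, Submodule.map_bot]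
  sub_univ := by
    rw [← Submodule.comap_injective_of_surjective (rootSpan G).mkQ_surjective |>.eq_iff,
      Submodule.comap_map_mkQ, sup_comm, edgeSpan_sup_rootSpan, Submodule.comap_top]
  sub_mono S T h := Submodule.map_mono (edgeSpan_mono G h)
  sub_eq S T h hr := by rw [edgeSpan_eq_of_rank_eq G h hr]

/-- The characteristic cohomology `H^{i,j}(M(G))` of the graphic matroid `M(G)` with its canonical
integral quasi-representation. -/
abbrev graphicCohomology [Finite G.vertexSet] [LinearOrder G.vertexSet] [Fintype G.edgeSet]
    [LinearOrder G.edgeSet] (i j : ℤ) : Type (max u v) :=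
  Cohomology (canonicalRep G) i j

end Graphic

end CharCoh

end

namespace CharCoh

noncomputable section

universe u v w

set_option linter.unusedSectionVars false

/-! ### The degree parts of an ideal generated by vectors in an exterior algebra -/

section ExteriorRelations

variable {R : Type v} [CommRing R] {N : Type w} [AddCommGroup N] [Module R N]

/-! Both groups are zero: they have the same total degree $i+j$, which is less than
$n-1=\operatorname{rank}M(G)$, and the cohomology vanishes in every total degree below the rank.

The vanishing is proved by deletion and contraction. Cochains are lifted to $\bigwedge N$, where
passing to $N/\rho(S)$ means working modulo the ideal generated by the edge vectors $v_e$, $e\in S$.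
All minors (contract $A$, restrict to $B$) then live in one algebra, and `IsExactAt` states
exactness for them.

Let $e$ be the largest element of the minor. The complex is, up to shift, the cone of the projection
from the complex of the deletion of $e$ to that of the contraction. If $e$ is not a coloop, deletion
keeps the rank, while contraction lowers both the rank (by at most one) and $i$; induction applies
to both (`isExactAt_insert`). If $e$ is a coloop, deletion loses rank. Instead, multiplication by
$v_e$ identifies the kernel of the projection with the complex of the contraction in exterior degree
$j-1$, so only the contraction is needed (`isExactAt_insert_of_dual`). This uses a functional equal
to $1$ on $v_e$ and $0$ on the other vectors involved.

Such integral functionals are where graphs enter: a coloop joins two components of the remaining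
graph, and the coordinate of one of them separates it (`exists_dual_of_graphicRank_ne`). They also
split $\rho(S)$ off $N$, which shows that the kernel of $\bigwedge N\to\bigwedge N/\rho(S)$ is the
stated ideal. -/

lemma extPow_eq_bot {j : ℤ} (hj : j < 0) : extPow R N j = ⊥ := by
  cases j with
  | ofNat k => exact absurd hj (by simp)
  | negSucc k => rfl

lemma extPow_natCast (k : ℕ) : extPow R N (k : ℤ) = LinearMap.range (ExteriorAlgebra.ι R) ^ k := rfl

lemma ι_mul_mem_extPow (n : N) {j : ℤ} {x : ExteriorAlgebra R N} (hx : x ∈ extPow R N (j - 1)) :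
    ExteriorAlgebra.ι R n * x ∈ extPow R N j := by
  rcases lt_or_ge (j - 1) 0 with hj | hj
  · rw [extPow_eq_bot hj, Submodule.mem_bot] at hx
    simp [hx]
  · obtain ⟨k, hk⟩ := Int.eq_ofNat_of_zero_le hj
    obtain rfl : j = ((k + 1 : ℕ) : ℤ) := by push_cast; omega
    rw [hk, extPow_natCast] at hx
    rw [extPow_natCast, pow_succ']
    exact Submodule.mul_mem_mul ⟨n, rfl⟩ hx

/-- Induction along the degree for elements of exterior powers. -/
lemma extPow_induction {p : ℤ → ExteriorAlgebra R N → Prop}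
    (zero : ∀ j, p j 0) (add : ∀ j x y, p j x → p j y → p j (x + y))
    (algebraMap : ∀ r, p 0 (algebraMap R _ r))
    (ι_mul : ∀ j n x, x ∈ extPow R N (j - 1) → p (j - 1) x → p j (ExteriorAlgebra.ι R n * x))
    {j : ℤ} {x : ExteriorAlgebra R N} (hx : x ∈ extPow R N j) : p j x := by
  rcases lt_or_ge j 0 with hj | hj
  · rw [extPow_eq_bot hj, Submodule.mem_bot] at hx
    exact hx ▸ zero j
  · obtain ⟨k, rfl⟩ := Int.eq_ofNat_of_zero_le hj
    rw [extPow_natCast] at hx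
    clear hj
    induction k generalizing x with
    | zero =>
      rw [pow_zero] at hx
      obtain ⟨r, rfl⟩ := Submodule.mem_one.1 hx
      exact algebraMap r
    | succ k ih =>
      rw [pow_succ'] at hx
      refine Submodule.mul_induction_on hx ?_ (add _)
      rintro _ ⟨n, rfl⟩ y hy
      have h : (((k + 1 : ℕ) : ℤ) - 1) = k := by push_cast; omega
      refine ι_mul _ n y ?_ ?_
      · rw [h, extPow_natCast]
        exact hy
      · rw [h]
        exact ih hy

lemma contractLeft_mem_extPow (φ : Module.Dual R N) {j : ℤ} {x : ExteriorAlgebra R N}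
    (hx : x ∈ extPow R N j) :
    CliffordAlgebra.contractLeft (Q := (0 : QuadraticForm R N)) φ x ∈ extPow R N (j - 1) := by
  refine extPow_induction (p := fun j x =>
    CliffordAlgebra.contractLeft (Q := (0 : QuadraticForm R N)) φ x ∈ extPow R N (j - 1))
    ?_ ?_ ?_ ?_ hx
  · intro j
    simp
  · intro j x y hx hy
    rw [map_add]
    exact add_mem hx hy
  · intro r
    rw [CliffordAlgebra.contractLeft_algebraMap]
    exact zero_mem _
  · intro j n x hx ih
    change CliffordAlgebra.contractLeft φ (CliffordAlgebra.ι _ n * x) ∈ _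
    rw [CliffordAlgebra.contractLeft_ι_mul]
    exact sub_mem (Submodule.smul_mem _ _ hx) (ι_mul_mem_extPow n ih)

lemma extPowMap_surjective {L : Type*} [AddCommGroup L] [Module R L] {f : N →ₗ[R] L}
    (hf : Function.Surjective f) (j : ℤ) : Function.Surjective (extPowMap f j) := by
  rintro ⟨y, hy⟩
  suffices h : ∃ x ∈ extPow R N j, ExteriorAlgebra.map f x = y by
    obtain ⟨x, hx, h⟩ := h
    exact ⟨⟨x, hx⟩, Subtype.ext h⟩
  refine extPow_induction (p := fun j y => ∃ x ∈ extPow R N j, ExteriorAlgebra.map f x = y)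
    ?_ ?_ ?_ ?_ hy
  · exact fun j => ⟨0, zero_mem _, map_zero _⟩
  · rintro j _ _ ⟨a, ha, rfl⟩ ⟨b, hb, rfl⟩
    exact ⟨a + b, add_mem ha hb, map_add _ _ _⟩
  · intro r
    refine ⟨algebraMap R _ r, ?_, AlgHom.commutes _ r⟩
    change _ ∈ extPow R N ((0 : ℕ) : ℤ)
    rw [extPow_natCast, pow_zero]
    exact Submodule.mem_one.2 ⟨r, rfl⟩
  · rintro j n _ - ⟨x, hx, rfl⟩
    obtain ⟨m, rfl⟩ := hf n
    exact ⟨ExteriorAlgebra.ι R m * x, ι_mul_mem_extPow m hx, by simp⟩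

variable {E : Type u} [DecidableEq E] (v : E → N)

/-- The degree `j` part of the ideal of the exterior algebra generated by the vectors `v e`,
`e ∈ S`. -/
def relIdeal (S : Finset E) (j : ℤ) : Submodule R (ExteriorAlgebra R N) :=
  ⨆ e ∈ S, (extPow R N (j - 1)).map (LinearMap.mulLeft R (ExteriorAlgebra.ι R (v e)))

variable {v}

lemma ι_mul_mem_relIdeal {S : Finset E} {e : E} (he : e ∈ S) {j : ℤ} {x : ExteriorAlgebra R N}
    (hx : x ∈ extPow R N (j - 1)) : ExteriorAlgebra.ι R (v e) * x ∈ relIdeal (R := R) v S j :=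
  Submodule.mem_iSup_of_mem e (Submodule.mem_iSup_of_mem he ⟨x, hx, rfl⟩)

lemma relIdeal_le {S : Finset E} {j : ℤ} {P : Submodule R (ExteriorAlgebra R N)}
    (h : ∀ e ∈ S, ∀ x ∈ extPow R N (j - 1), ExteriorAlgebra.ι R (v e) * x ∈ P) :
    relIdeal v S j ≤ P := by
  refine iSup₂_le fun e he => ?_
  rintro _ ⟨x, hx, rfl⟩
  exact h e he x hx

lemma relIdeal_mono {S T : Finset E} (h : S ⊆ T) (j : ℤ) :
    relIdeal (R := R) v S j ≤ relIdeal v T j :=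
  relIdeal_le fun _ he _ hx => ι_mul_mem_relIdeal (h he) hx

lemma ι_mul_ι_mul (m n : N) (x : ExteriorAlgebra R N) :
    ExteriorAlgebra.ι R m * (ExteriorAlgebra.ι R n * x) =
      -(ExteriorAlgebra.ι R n * (ExteriorAlgebra.ι R m * x)) := by
  rw [← mul_assoc, ← mul_assoc, ← neg_mul, eq_neg_of_add_eq_zero_left
    (ExteriorAlgebra.ι_add_mul_swap m n)]

lemma ι_mul_relIdeal (n : N) {S : Finset E} {j : ℤ} {x : ExteriorAlgebra R N}
    (hx : x ∈ relIdeal v S (j - 1)) : ExteriorAlgebra.ι R n * x ∈ relIdeal v S j := by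
  have h : relIdeal v S (j - 1) ≤
      (relIdeal v S j).comap (LinearMap.mulLeft R (ExteriorAlgebra.ι R n)) := by
    refine relIdeal_le fun e he y hy => ?_
    rw [Submodule.mem_comap, LinearMap.mulLeft_apply, ι_mul_ι_mul]
    exact neg_mem (ι_mul_mem_relIdeal he (ι_mul_mem_extPow n hy))
  exact h hx

/-- The generator $v_e$ is killed because $v_e\wedge v_e=0$. Hence multiplication by $v_e$ descends
to a map from the quotient modulo $S\cup e$ to the quotient modulo $S$. -/
lemma ι_mul_relIdeal_insert {S : Finset E} {e : E} {j : ℤ} {x : ExteriorAlgebra R N}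
    (hx : x ∈ relIdeal v (insert e S) (j - 1)) :
    ExteriorAlgebra.ι R (v e) * x ∈ relIdeal v S j := by
  have h : relIdeal v (insert e S) (j - 1) ≤
      (relIdeal v S j).comap (LinearMap.mulLeft R (ExteriorAlgebra.ι R (v e))) := by
    refine relIdeal_le fun f hf y hy => ?_
    rw [Submodule.mem_comap, LinearMap.mulLeft_apply]
    rcases Finset.mem_insert.1 hf with rfl | hf
    · rw [← mul_assoc, ExteriorAlgebra.ι_sq_zero, zero_mul]
      exact zero_mem _
    · rw [ι_mul_ι_mul]
      exact neg_mem (ι_mul_mem_relIdeal hf (ι_mul_mem_extPow _ hy))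
  exact h hx

lemma exists_of_mem_relIdeal_insert {S : Finset E} {e : E} {j : ℤ} {x : ExteriorAlgebra R N}
    (hx : x ∈ relIdeal v (insert e S) j) :
    ∃ w ∈ extPow R N (j - 1), x - ExteriorAlgebra.ι R (v e) * w ∈ relIdeal v S j := by
  have h : relIdeal v (insert e S) j ≤
      (extPow R N (j - 1)).map (LinearMap.mulLeft R (ExteriorAlgebra.ι R (v e))) ⊔
        relIdeal v S j := by
    refine relIdeal_le fun f hf y hy => ?_
    rcases Finset.mem_insert.1 hf with rfl | hf
    · exact Submodule.mem_sup_left ⟨y, hy, rfl⟩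
    · exact Submodule.mem_sup_right (ι_mul_mem_relIdeal hf hy)
  obtain ⟨_, ⟨w, hw, rfl⟩, z, hz, rfl⟩ := Submodule.mem_sup.1 (h hx)
  exact ⟨w, hw, by simpa using hz⟩

/-- If a functional is `1` on `v e` and vanishes on the `v f`, `f ∈ S`, then multiplication by
`v e` is injective from the exterior algebra modulo `S ∪ {e}` to the exterior algebra
modulo `S`. -/
lemma mem_relIdeal_insert_of_ι_mul_mem {S : Finset E} {e : E} (φ : Module.Dual R N)
    (hφ : φ (v e) = 1) (hS : ∀ f ∈ S, φ (v f) = 0) {j : ℤ} {x : ExteriorAlgebra R N}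
    (hx : x ∈ extPow R N (j - 1)) (h : ExteriorAlgebra.ι R (v e) * x ∈ relIdeal v S j) :
    x ∈ relIdeal v (insert e S) (j - 1) := by
  -- Contraction with $\varphi$ is an antiderivation killing the generators $v_f$, so it preserves
  -- the ideal. Applied to $v_e\wedge x$ it gives $x-v_e\wedge(\varphi\lrcorner x)$, which
  -- determines $x$ modulo $v_e$.
  have hc : relIdeal v S j ≤ (relIdeal v S (j - 1)).comap
      (CliffordAlgebra.contractLeft (Q := (0 : QuadraticForm R N)) φ) := by
    refine relIdeal_le fun f hf y hy => ?_
    rw [Submodule.mem_comap]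
    change CliffordAlgebra.contractLeft φ (CliffordAlgebra.ι _ (v f) * y) ∈ _
    rw [CliffordAlgebra.contractLeft_ι_mul, hS f hf, zero_smul, zero_sub]
    exact neg_mem (ι_mul_mem_relIdeal hf (contractLeft_mem_extPow φ hy))
  have h1 := hc h
  rw [Submodule.mem_comap] at h1
  change CliffordAlgebra.contractLeft φ (CliffordAlgebra.ι _ (v e) * x) ∈ _ at h1
  rw [CliffordAlgebra.contractLeft_ι_mul, hφ, one_smul] at h1
  have h2 : ExteriorAlgebra.ι R (v e) *
      CliffordAlgebra.contractLeft (Q := (0 : QuadraticForm R N)) φ x ∈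
        relIdeal v (insert e S) (j - 1) :=
    ι_mul_mem_relIdeal (Finset.mem_insert_self e S) (contractLeft_mem_extPow φ hx)
  have h3 := add_mem (relIdeal_mono (Finset.subset_insert e S) _ h1) h2
  convert h3 using 1
  exact (sub_add_cancel _ _).symm

lemma ι_mul_mem_relIdeal_of_mem_span {S : Finset E} {n : N} (hn : n ∈ Submodule.span R (v '' S))
    {j : ℤ} {x : ExteriorAlgebra R N} (hx : x ∈ extPow R N (j - 1)) :
    ExteriorAlgebra.ι R n * x ∈ relIdeal v S j := by
  induction hn using Submodule.span_induction with
  | mem _ h =>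
    obtain ⟨e, he, rfl⟩ := h
    exact ι_mul_mem_relIdeal he hx
  | zero => simp
  | add a b _ _ ha hb =>
    rw [map_add, add_mul]
    exact add_mem ha hb
  | smul r a _ ha =>
    rw [map_smul, smul_mul_assoc]
    exact Submodule.smul_mem _ r ha

/-- Factor by factor: $n\wedge x-pn\wedge px=(n-pn)\wedge x+pn\wedge(x-px)$. -/
lemma sub_map_mem_relIdeal {S : Finset E} {p : N →ₗ[R] N}
    (hp : ∀ n, n - p n ∈ Submodule.span R (v '' S)) {j : ℤ} {x : ExteriorAlgebra R N}
    (hx : x ∈ extPow R N j) : x - ExteriorAlgebra.map p x ∈ relIdeal v S j := by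
  refine extPow_induction (p := fun j x => x - ExteriorAlgebra.map p x ∈ relIdeal v S j)
    ?_ ?_ ?_ ?_ hx
  · simp
  · intro j x y hx hy
    rw [map_add, add_sub_add_comm]
    exact add_mem hx hy
  · intro r
    rw [AlgHom.commutes, sub_self]
    exact zero_mem _
  · intro j n x hx ih
    have h := add_mem (ι_mul_mem_relIdeal_of_mem_span (hp n) hx) (ι_mul_relIdeal (p n) ih)
    convert h using 1
    rw [map_mul, ExteriorAlgebra.map_apply_ι, map_sub, sub_mul, mul_sub]
    abel

/-- The kernel of `⋀ N → ⋀ (N / P)` for a split submodule `P` spanned by the `v e`, `e ∈ S`. -/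
lemma mem_relIdeal_of_map_mkQ_eq_zero {S : Finset E} {P : Submodule R N}
    (hP : P = Submodule.span R (v '' S)) {p : N →ₗ[R] N} (hp : ∀ n, n - p n ∈ P)
    (hpP : P ≤ LinearMap.ker p) {j : ℤ} {x : ExteriorAlgebra R N} (hx : x ∈ extPow R N j)
    (h : ExteriorAlgebra.map P.mkQ x = 0) : x ∈ relIdeal v S j := by
  have h1 := sub_map_mem_relIdeal (v := v) (S := S) (hP ▸ hp) hx
  -- Since $p$ factors through $N/P$, the image of $x$ under $p$ vanishes.
  rw [← Submodule.liftQ_mkQ P p hpP, ← ExteriorAlgebra.map_comp_map, AlgHom.comp_apply, h,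
    map_zero, sub_zero] at h1
  exact h1

lemma map_mkQ_eq_zero_of_mem_relIdeal {S : Finset E} {P : Submodule R N}
    (hP : ∀ e ∈ S, v e ∈ P) {j : ℤ} {x : ExteriorAlgebra R N}
    (h : x ∈ relIdeal v S j) : ExteriorAlgebra.map P.mkQ x = 0 := by
  have h1 : relIdeal v S j ≤ LinearMap.ker (ExteriorAlgebra.map P.mkQ).toLinearMap := by
    refine relIdeal_le fun e he y _ => ?_
    rw [LinearMap.mem_ker, AlgHom.toLinearMap_apply, map_mul, ExteriorAlgebra.map_apply_ι,
      Submodule.mkQ_apply, (Submodule.Quotient.mk_eq_zero P).2 (hP e he), map_zero, zero_mul]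
  exact h1 h

end ExteriorRelations

/-! ### Signed coboundaries with constant coefficients -/

section Coboundary

variable {R : Type v} [CommRing R] {E : Type u} [LinearOrder E] {L : Type w} [AddCommGroup L]
  [Module R L]

/-- The coboundary of a function on finite sets with values in a fixed module. -/
def coboundary (R : Type v) [CommRing R] {L : Type w} [AddCommGroup L] [Module R L]
    (x : Finset E → L) (T : Finset E) : L :=
  ∑ f ∈ T, edgeSign R (T.erase f) f • x (T.erase f)

lemma coboundary_congr {x y : Finset E → L} {T : Finset E} (h : ∀ S ⊆ T, x S = y S) :
    coboundary R x T = coboundary R y T :=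
  Finset.sum_congr rfl fun f _ => by rw [h _ (Finset.erase_subset f T)]

lemma coboundary_add (x y : Finset E → L) (T : Finset E) :
    coboundary R (fun S => x S + y S) T = coboundary R x T + coboundary R y T := by
  simp [coboundary, Finset.sum_add_distrib]

lemma coboundary_sub (x y : Finset E → L) (T : Finset E) :
    coboundary R (fun S => x S - y S) T = coboundary R x T - coboundary R y T := by
  simp [coboundary, smul_sub]

lemma coboundary_map {L' : Type*} [AddCommGroup L'] [Module R L'] (g : L →ₗ[R] L')
    (x : Finset E → L) (T : Finset E) :
    coboundary R (fun S => g (x S)) T = g (coboundary R x T) := by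
  simp [coboundary]

lemma coboundary_mem {P : Submodule R L} {x : Finset E → L} {T : Finset E}
    (h : ∀ f ∈ T, x (T.erase f) ∈ P) : coboundary R x T ∈ P :=
  Submodule.sum_mem _ fun f hf => Submodule.smul_mem _ _ (h f hf)

lemma coboundary_sign (x : Finset E → L) (T : Finset E) :
    coboundary R (fun S => (-1 : R) ^ S.card • x S) T =
      -((-1 : R) ^ T.card • coboundary R x T) := by
  rw [coboundary, coboundary, Finset.smul_sum, ← Finset.sum_neg_distrib]
  refine Finset.sum_congr rfl fun f hf => ?_
  rw [← Finset.card_erase_add_one hf, pow_succ, smul_comm]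
  simp

/-- As $e$ is larger than all of $S$, its own sign is $(-1)^{|S|}$ and it does not affect the other
signs. This is the cone structure that drives the inductions, and the reason for always adding a
maximal element. -/
lemma coboundary_insert (x : Finset E → L) {S : Finset E} {e : E} (h : ∀ f ∈ S, f < e) :
    coboundary R x (insert e S) =
      (-1 : R) ^ S.card • x S + coboundary R (fun S' => x (insert e S')) S := by
  have he : e ∉ S := fun he => lt_irrefl _ (h e he)
  rw [coboundary, Finset.sum_insert he, Finset.erase_insert he]
  congr 1
  · rw [edgeSign, Finset.filter_true_of_mem h]
  · refine Finset.sum_congr rfl fun f hf => ?_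
    rw [Finset.erase_insert_of_ne (h f hf).ne']
    congr 1
    rw [edgeSign, edgeSign, Finset.filter_insert, if_neg (h f hf).not_gt]

lemma coboundary_coboundary (x : Finset E → L) (T : Finset E) :
    coboundary R (coboundary R x) T = 0 := by
  induction T using Finset.induction_on_max generalizing x with
  | empty => simp [coboundary]
  | insert e T hT ih =>
    rw [coboundary_insert _ hT, coboundary_congr (y := fun S =>
      (-1 : R) ^ S.card • x S + coboundary R (fun S' => x (insert e S')) S)
      fun S hS => coboundary_insert x fun f hf => hT f (hS hf), coboundary_add, coboundary_sign,
      ih (fun S' => x (insert e S'))]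
    simp

end Coboundary

/-! ### Deletion and contraction for the lifted complexes -/

section Acyclicity

variable {R : Type v} [CommRing R] {N : Type w} [AddCommGroup N] [Module R N]
  {E : Type u} [LinearOrder E] (v : E → N)

/-- Exactness in bidegree `(i, j)` of the complex of the minor obtained by contracting `A` and
restricting to `B`, expressed by cochains lifted to the exterior algebra of `N`. -/
def IsExactAt (R : Type v) [CommRing R] {N : Type w} [AddCommGroup N] [Module R N]
    (v : E → N) (A B : Finset E) (i j : ℤ) : Prop :=
  ∀ x : Finset E → ExteriorAlgebra R N, (∀ S, x S ∈ extPow R N j) →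
    (∀ T ⊆ B, (T.card : ℤ) = i + 1 → coboundary R x T ∈ relIdeal v (A ∪ T) j) →
    ∃ y : Finset E → ExteriorAlgebra R N, (∀ S, y S ∈ extPow R N j) ∧
      ∀ S ⊆ B, (S.card : ℤ) = i → x S - coboundary R y S ∈ relIdeal v (A ∪ S) j

variable {v}

lemma isExactAt_of_neg {A B : Finset E} {i j : ℤ} (h : i + j < 0) : IsExactAt R v A B i j := by
  intro x hx _
  refine ⟨0, fun S => zero_mem _, fun S _ hS => ?_⟩
  -- Here $i=|S|\ge 0$; for negative $i$ there is no such $S$.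
  have hj : j < 0 := by omega
  have h0 := hx S
  rw [extPow_eq_bot hj, Submodule.mem_bot] at h0
  rw [h0]
  simp [coboundary]

lemma subset_or_exists_eq_insert {B S : Finset E} {e : E} (hS : S ⊆ insert e B) :
    S ⊆ B ∨ ∃ S' ⊆ B, S = insert e S' := by
  by_cases he : e ∈ S
  · exact Or.inr ⟨S.erase e, Finset.subset_insert_iff.1 hS, (Finset.insert_erase he).symm⟩
  · exact Or.inl ((Finset.subset_insert_iff_of_notMem he).1 hS)

/-- Exactness for the deletion and for the contraction of `e` imply exactness. -/
lemma isExactAt_insert {A B : Finset E} {e : E} (hB : ∀ f ∈ B, f < e) {i j : ℤ}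
    (hdel : IsExactAt R v A B i j) (hcon : IsExactAt R v (insert e A) B (i - 1) j) :
    IsExactAt R v A (insert e B) i j := by
  intro x hx hcoc
  have he : ∀ S ⊆ B, e ∉ S := fun S hS h => lt_irrefl _ (hB e (hS h))
  obtain ⟨y, hy, hxy⟩ := hdel x hx fun T hT => hcoc T (hT.trans (Finset.subset_insert e B))
  -- With the primitive $y$ of the deletion part subtracted, the part of $x$ on sets containing $e$
  -- becomes a cocycle of the contraction.
  obtain ⟨z, hz, hxz⟩ := hcon (fun S => x (insert e S) - (-1 : R) ^ S.card • y S)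
    (fun S => sub_mem (hx _) (Submodule.smul_mem _ _ (hy S))) (by
      intro T hT hTc
      have h1 := hcoc (insert e T) (Finset.insert_subset_insert e hT) (by
        rw [Finset.card_insert_of_notMem (he T hT)]
        push_cast
        omega)
      rw [coboundary_insert _ fun f hf => hB f (hT hf)] at h1
      have h2 := relIdeal_mono (R := R) (v := v)
        (Finset.union_subset_union_right (s := A) (Finset.subset_insert e T)) j
        (hxy T hT (by omega))
      rw [coboundary_sub, coboundary_sign, Finset.insert_union, ← Finset.union_insert]
      convert sub_mem h1 (Submodule.smul_mem _ ((-1 : R) ^ T.card) h2) using 1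
      rw [smul_sub]
      abel)
  refine ⟨fun S => if e ∈ S then z (S.erase e) else y S, fun S => ?_, fun S hSB hSc => ?_⟩
  · dsimp only
    split_ifs
    exacts [hz _, hy _]
  · rcases subset_or_exists_eq_insert hSB with hS | ⟨S, hS, rfl⟩
    · rw [coboundary_congr (y := y) fun S' hS' => if_neg (he S' (hS'.trans hS))]
      exact hxy S hS hSc
    · rw [Finset.card_insert_of_notMem (he S hS)] at hSc
      push_cast at hSc
      have h1 := hxz S hS (by omega)
      rw [coboundary_insert _ fun f hf => hB f (hS hf), if_neg (he S hS),
        coboundary_congr (y := z) fun S' hS' => by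
          rw [if_pos (Finset.mem_insert_self e S'), Finset.erase_insert (he S' (hS'.trans hS))],
        Finset.union_insert, ← Finset.insert_union, ← sub_sub]
      exact h1

/-- For a coloop `e`, exactness for the contraction of `e` implies exactness one degree
higher. -/
lemma isExactAt_insert_of_dual {A B : Finset E} {e : E} (hB : ∀ f ∈ B, f < e) {i j : ℤ}
    (φ : Module.Dual R N) (hφ : φ (v e) = 1) (hAB : ∀ f ∈ A ∪ B, φ (v f) = 0)
    (hcon : IsExactAt R v (insert e A) B i (j - 1)) : IsExactAt R v A (insert e B) i j := by
  intro x hx hcoc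
  have he : ∀ S ⊆ B, e ∉ S := fun S hS h => lt_irrefl _ (hB e (hS h))
  -- Up to sign, $u(S)$ is the coboundary of $x$ at $S\cup e$. So it vanishes modulo $S\cup e\cup A$
  -- and can be written as $v_e\wedge w$ modulo $A\cup S$. It differs from $x$ by an exact term, so
  -- $du=dx$.
  set u : Finset E → ExteriorAlgebra R N := fun S =>
    x S + (-1 : R) ^ S.card • coboundary R (fun S' => x (insert e S')) S with hu
  have hdu : ∀ T, coboundary R u T = coboundary R x T := by
    intro T
    rw [hu, coboundary_add, coboundary_sign, coboundary_coboundary, smul_zero, neg_zero, add_zero]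
  have hw : ∀ S, ∃ w ∈ extPow R N (j - 1), S ⊆ B → (S.card : ℤ) = i →
      u S - ExteriorAlgebra.ι R (v e) * w ∈ relIdeal v (A ∪ S) j := by
    intro S
    by_cases hS : S ⊆ B ∧ (S.card : ℤ) = i
    · have h1 := hcoc (insert e S) (Finset.insert_subset_insert e hS.1) (by
        rw [Finset.card_insert_of_notMem (he S hS.1)]
        push_cast
        omega)
      rw [coboundary_insert _ fun f hf => hB f (hS.1 hf), Finset.union_insert] at h1
      have h2 : u S ∈ relIdeal v (insert e (A ∪ S)) j := by
        convert Submodule.smul_mem _ ((-1 : R) ^ S.card) h1 using 1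
        rw [hu, smul_add, smul_smul, ← mul_pow]
        simp
      obtain ⟨w, hw, h3⟩ := exists_of_mem_relIdeal_insert h2
      exact ⟨w, hw, fun _ _ => h3⟩
    · exact ⟨0, zero_mem _, fun h1 h2 => absurd ⟨h1, h2⟩ hS⟩
  choose w hw huw using hw
  obtain ⟨z, hz, hwz⟩ := hcon w hw (by
    intro T hT hTc
    rw [Finset.insert_union]
    -- Cancelling $v_e$ from $v_e\wedge dw\equiv du=dx\equiv 0$ makes $w$ a cocycle of the
    -- contraction.
    refine mem_relIdeal_insert_of_ι_mul_mem φ hφ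
      (fun f hf => hAB f (Finset.union_subset_union_right hT hf))
      (coboundary_mem fun f _ => hw _) ?_
    have h1 := hcoc T (hT.trans (Finset.subset_insert e B)) hTc
    have h2 : coboundary R (fun S => u S - LinearMap.mulLeft R (ExteriorAlgebra.ι R (v e)) (w S)) T
        ∈ relIdeal v (A ∪ T) j := by
      refine coboundary_mem fun f hf => relIdeal_mono
        (Finset.union_subset_union_right (Finset.erase_subset f T)) j
        (huw _ ((Finset.erase_subset f T).trans hT) ?_)
      have := Finset.card_erase_add_one hf
      omega
    rw [coboundary_sub, coboundary_map, hdu, LinearMap.mulLeft_apply] at h2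
    simpa using sub_mem h1 h2)
  -- On sets without $e$, $x-dy=u-v_e\wedge dz=(u-v_e\wedge w)+v_e\wedge(w-dz)$. On $S\cup e$ only
  -- $\pm v_e\wedge z(S)$ is left, which lies in the ideal.
  refine ⟨fun S => if e ∈ S then 0 else
    (-1 : R) ^ S.card • x (insert e S) +
      LinearMap.mulLeft R (ExteriorAlgebra.ι R (v e)) (z S), fun S => ?_, fun S hSB hSc => ?_⟩
  · dsimp only
    split_ifs
    · exact zero_mem _
    · exact add_mem (Submodule.smul_mem _ _ (hx _)) (ι_mul_mem_extPow _ (hz S))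
  · rcases subset_or_exists_eq_insert hSB with hS | ⟨S, hS, rfl⟩
    · rw [coboundary_congr (y := fun S => (-1 : R) ^ S.card • x (insert e S) +
          LinearMap.mulLeft R (ExteriorAlgebra.ι R (v e)) (z S))
          fun S' hS' => if_neg (he S' (hS'.trans hS)),
        coboundary_add, coboundary_sign, coboundary_map, LinearMap.mulLeft_apply]
      have h1 := hwz S hS hSc
      rw [Finset.insert_union] at h1
      convert add_mem (huw S hS hSc) (ι_mul_relIdeal_insert h1) using 1
      rw [mul_sub, sub_add_sub_cancel, sub_add_eq_sub_sub, sub_neg_eq_add]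
    · rw [coboundary_insert _ fun f hf => hB f (hS hf), if_neg (he S hS),
        coboundary_congr (y := fun _ => 0) fun S' _ => if_pos (Finset.mem_insert_self e S')]
      have h1 : ExteriorAlgebra.ι R (v e) * z S ∈
          relIdeal (R := R) v (A ∪ insert e S) j :=
        ι_mul_mem_relIdeal (Finset.mem_union_right _ (Finset.mem_insert_self e S)) (hz S)
      convert Submodule.smul_mem _ (-(-1 : R) ^ S.card) h1 using 1
      rw [smul_add, smul_smul, ← mul_pow]
      simp [coboundary]

/-- The minor obtained by contracting `A` and restricting to `B` has exact complex in bidegrees of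
total degree below its rank, provided that every coloop of a restriction is split off by a
functional. -/
lemma isExactAt_of_lt_rank (M : RankMatroid E)
    (hdual : ∀ (S : Finset E) (e : E), M.rk (insert e S) ≠ M.rk S →
      ∃ φ : Module.Dual R N, φ (v e) = 1 ∧ ∀ f ∈ S, φ (v f) = 0)
    (A B : Finset E) (i j : ℤ) (h : i + j + M.rk A < M.rk (A ∪ B)) : IsExactAt R v A B i j := by
  induction B using Finset.induction_on_max generalizing A i j with
  | empty =>
    rw [Finset.union_empty] at h
    exact isExactAt_of_neg (by omega)
  | insert e B hB ih =>
    -- Contracting $e$ costs at most one in rank; each use of the contraction below also lowers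
    -- $i+j$ by one.
    have hA : M.rk (insert e A) ≤ M.rk A + 1 := by
      have h1 := M.rk_submod A {e}
      have h2 := M.rk_le_card {e}
      rw [Finset.card_singleton] at h2
      rw [Finset.union_comm, ← Finset.insert_eq] at h1
      omega
    rw [Finset.union_insert] at h
    by_cases hr : M.rk (insert e (A ∪ B)) = M.rk (A ∪ B)
    · refine isExactAt_insert hB (ih A i j (by omega)) (ih (insert e A) (i - 1) j ?_)
      rw [Finset.insert_union]
      omega
    · obtain ⟨φ, hφ, hAB⟩ := hdual _ e hr
      refine isExactAt_insert_of_dual hB φ hφ hAB (ih (insert e A) i (j - 1) ?_)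
      rw [Finset.insert_union]
      omega

end Acyclicity

/-! ### From lifted exactness to vanishing of cohomology -/

section Vanishing

variable {R : Type v} [CommRing R] [IsDomain R] [IsPrincipalIdealRing R]
  {E : Type u} [Fintype E] [LinearOrder E]
  {M : RankMatroid E} {N : Type w} [AddCommGroup N] [Module R N] [Module.Finite R N]

/-- Gram–Schmidt with the functionals of `hdual`: each rank-increasing element gives a correction of
the projection built so far. -/
lemma exists_splitting (ρ : QuasiRep R M N) {v : E → N}
    (hv : ∀ S, ρ.sub S = Submodule.span R (v '' S))
    (hdual : ∀ (S : Finset E) (e : E), M.rk (insert e S) ≠ M.rk S →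
      ∃ φ : Module.Dual R N, φ (v e) = 1 ∧ ∀ f ∈ S, φ (v f) = 0) (S : Finset E) :
    ∃ p : N →ₗ[R] N, (∀ n, n - p n ∈ ρ.sub S) ∧ ρ.sub S ≤ LinearMap.ker p := by
  induction S using Finset.induction_on with
  | empty => exact ⟨LinearMap.id, by simp, by simp [ρ.sub_empty]⟩
  | insert e S _ ih =>
    obtain ⟨p, hp, hpS⟩ := ih
    by_cases hr : M.rk (insert e S) = M.rk S
    · rw [← ρ.sub_eq (Finset.subset_insert e S) hr.symm]
      exact ⟨p, hp, hpS⟩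
    · obtain ⟨φ, hφ, hS⟩ := hdual S e hr
      have hmono := ρ.sub_mono (Finset.subset_insert e S)
      have he : v e ∈ ρ.sub (insert e S) := by
        rw [hv]
        exact Submodule.subset_span ⟨e, by simp, rfl⟩
      -- Subtracting $\varphi(\cdot)\,p(v_e)$ kills $v_e$, as $\varphi(v_e)=1$, and leaves the
      -- values on the $v_f$, $f\in S$, at zero.
      refine ⟨p - φ.smulRight (p (v e)), fun n => ?_, ?_⟩
      · have h1 := hmono (hp n)
        have h2 : p (v e) ∈ ρ.sub (insert e S) := by
          simpa using sub_mem he (hmono (hp (v e)))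
        convert add_mem h1 (Submodule.smul_mem _ (φ n) h2) using 1
        simp only [LinearMap.sub_apply, LinearMap.smulRight_apply]
        abel
      · rw [hv, Submodule.span_le]
        rintro _ ⟨f, hf, rfl⟩
        rcases Finset.mem_insert.1 (Finset.mem_coe.1 hf) with rfl | hf
        · simp [hφ]
        · have : p (v f) = 0 := hpS (by
            rw [hv]
            exact Submodule.subset_span ⟨f, hf, rfl⟩)
          simp [this, hS f hf]

lemma map_quotMap_map_mkQ (ρ : QuasiRep R M N) {S T : Finset E} (h : S ⊆ T)
    (x : ExteriorAlgebra R N) :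
    ExteriorAlgebra.map (quotMap ρ h) (ExteriorAlgebra.map (ρ.sub S).mkQ x) =
      ExteriorAlgebra.map (ρ.sub T).mkQ x := by
  rw [← AlgHom.comp_apply, ExteriorAlgebra.map_comp_map]
  rfl

/-- The differential of a cochain lifted to the exterior algebra of `N`. -/
lemma d_apply_of_lift (ρ : QuasiRep R M N) {i i' j : ℤ} (h : i + 1 = i') (x : Cochain ρ i j)
    (X : Finset E → ExteriorAlgebra R N)
    (hX : ∀ S : {S : Finset E // (S.card : ℤ) = i},
      (x S).1 = ExteriorAlgebra.map (ρ.sub S.1).mkQ (X S.1))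
    (T : {S : Finset E // (S.card : ℤ) = i'}) :
    (d ρ i i' j h x T).1 = ExteriorAlgebra.map (ρ.sub T.1).mkQ (coboundary R X T.1) := by
  rw [d_apply_coe, coboundary, map_sum, ← Finset.sum_coe_sort T.1]
  refine Finset.sum_congr rfl fun e _ => ?_
  rw [hX, map_quotMap_map_mkQ, map_smul]

/-- The characteristic cohomology vanishes in total degree below the rank, if `ρ` is given by
vectors such that every coloop of a restriction is split off by a functional. -/
theorem subsingleton_cohomology (ρ : QuasiRep R M N) {v : E → N}
    (hv : ∀ S, ρ.sub S = Submodule.span R (v '' S))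
    (hdual : ∀ (S : Finset E) (e : E), M.rk (insert e S) ≠ M.rk S →
      ∃ φ : Module.Dual R N, φ (v e) = 1 ∧ ∀ f ∈ S, φ (v f) = 0)
    {i j : ℤ} (h : i + j < M.rk Finset.univ) : Subsingleton (Cohomology ρ i j) := by
  rw [Submodule.Quotient.subsingleton_iff, Submodule.submoduleOf_eq_top]
  intro x hx
  have hlift : ∀ S : Finset E, ∃ X ∈ extPow R N j, ∀ hS : (S.card : ℤ) = i,
      (x ⟨S, hS⟩).1 = ExteriorAlgebra.map (ρ.sub S).mkQ X := by
    intro S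
    by_cases hS : (S.card : ℤ) = i
    · obtain ⟨X, hX⟩ := extPowMap_surjective (ρ.sub S).mkQ_surjective j (x ⟨S, hS⟩)
      exact ⟨X.1, X.2, fun _ => congrArg Subtype.val hX.symm⟩
    · exact ⟨0, zero_mem _, fun h => absurd h hS⟩
  choose X hX hxX using hlift
  have hempty : M.rk ∅ = 0 := Nat.le_zero.1 (M.rk_le_card ∅)
  obtain ⟨y, hy, hXy⟩ := isExactAt_of_lt_rank M hdual ∅ Finset.univ i j
    (by simpa [hempty] using h) X hX (by
      intro T _ hT
      rw [Finset.empty_union]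
      obtain ⟨p, hp, hpT⟩ := exists_splitting ρ hv hdual T
      refine mem_relIdeal_of_map_mkQ_eq_zero (hv T) hp hpT (coboundary_mem fun f _ => hX _) ?_
      have h1 := d_apply_of_lift ρ rfl x X (fun S => hxX S.1 S.2) ⟨T, hT⟩
      rw [LinearMap.mem_ker.1 hx] at h1
      exact h1.symm)
  let Y : Cochain ρ (i - 1) j := fun S => extPowMap (ρ.sub S.1).mkQ j ⟨y S.1, hy S.1⟩
  refine ⟨Y, ?_⟩
  funext S
  apply Subtype.ext
  refine (d_apply_of_lift ρ (sub_add_cancel i 1) Y y (fun _ => rfl) S).trans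
    (Eq.trans ?_ (hxX S.1 S.2).symm)
  have h1 := hXy S.1 (Finset.subset_univ _) S.2
  rw [Finset.empty_union] at h1
  have h2 := map_mkQ_eq_zero_of_mem_relIdeal (P := ρ.sub S.1) (fun e he => by
    rw [hv]
    exact Submodule.subset_span ⟨e, he, rfl⟩) h1
  rw [map_sub, sub_eq_zero] at h2
  exact h2.symm

end Vanishing

/-! ### Separating functionals for graphs -/

section GraphicVanishing

variable {α : Type u} {β : Type v} (G : Graph α β)

lemma exists_ends (e : G.edgeSet) :
    ∃ p : G.vertexSet × G.vertexSet, G.IsLink e.1 p.1.1 p.2.1 := by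
  obtain ⟨x, y, h⟩ := Graph.exists_isLink_of_mem_edgeSet e.2
  exact ⟨⟨⟨x, h.left_mem⟩, ⟨y, h.right_mem⟩⟩, h⟩

/-- The difference of the ends of an edge, for some choice of an orientation. -/
def edgeVec (e : G.edgeSet) : G.vertexSet →₀ ℤ :=
  Finsupp.single (exists_ends G e).choose.1 1 - Finsupp.single (exists_ends G e).choose.2 1

lemma edgeSpan_eq_span (S : Finset G.edgeSet) :
    edgeSpan G S = Submodule.span ℤ (edgeVec G '' S) := by
  apply le_antisymm
  · refine Submodule.span_le.2 ?_
    rintro _ ⟨e, he, x, y, hl, rfl⟩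
    have hf : edgeVec G e ∈ Submodule.span ℤ (edgeVec G '' S) :=
      Submodule.subset_span ⟨e, he, rfl⟩
    rcases hl.eq_and_eq_or_eq_and_eq (exists_ends G e).choose_spec with ⟨h1, h2⟩ | ⟨h1, h2⟩
    · rw [Subtype.ext h1, Subtype.ext h2]
      exact hf
    · rw [Subtype.ext h1, Subtype.ext h2]
      simpa [edgeVec] using neg_mem hf
  · refine Submodule.span_le.2 ?_
    rintro _ ⟨e, he, rfl⟩
    exact Submodule.subset_span ⟨e, he, _, _, (exists_ends G e).choose_spec, rfl⟩

lemma exists_dual_of_graphicRank_ne [Finite G.vertexSet] [LinearOrder G.vertexSet]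
    [Fintype G.edgeSet] [DecidableEq G.edgeSet] (S : Finset G.edgeSet) (e : G.edgeSet)
    (h : graphicRank G (insert e S) ≠ graphicRank G S) :
    ∃ φ : Module.Dual ℤ ((G.vertexSet →₀ ℤ) ⧸ rootSpan G),
      φ ((rootSpan G).mkQ (edgeVec G e)) = 1 ∧
        ∀ f ∈ S, φ ((rootSpan G).mkQ (edgeVec G f)) = 0 := by
  classical
  obtain ⟨⟨x, y⟩, hxy⟩ : ∃ p, p = (exists_ends G e).choose := ⟨_, rfl⟩
  have hvec : edgeVec G e = Finsupp.single x 1 - Finsupp.single y 1 := by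
    rw [edgeVec, ← hxy]
  -- If the ends of $e$ were already connected in $[G:S]$, then $v_e$ would lie in the span of $S$
  -- and the rank would not grow.
  have hne : (spanningGraph G S).connectedComponentMk y ≠
      (spanningGraph G S).connectedComponentMk x := by
    intro hc
    apply h
    rw [← finrank_edgeSpan, ← finrank_edgeSpan]
    refine congrArg (fun P : Submodule ℤ (G.vertexSet →₀ ℤ) => Module.finrank ℤ P) ?_
    refine le_antisymm ?_ (edgeSpan_mono G (Finset.subset_insert e S))
    rw [edgeSpan_eq_span, Submodule.span_le]
    rintro _ ⟨f, hf, rfl⟩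
    rcases Finset.mem_insert.1 (Finset.mem_coe.1 hf) with rfl | hf
    · rw [hvec]
      exact sub_mem_edgeSpan G S (SimpleGraph.ConnectedComponent.eq.1 hc.symm)
    · rw [edgeSpan_eq_span]
      exact Submodule.subset_span ⟨f, hf, rfl⟩
  choose r hr using fun F : Conn G Finset.univ => exists_isLeast G F
  -- The sum of the coefficients over the component of $x$ in $[G:S]$ is $1$ on $x-y$ and $0$ on
  -- edges of $S$. It need not vanish on $I_G$, so $\psi$ first subtracts from each vertex the least
  -- vertex of its component in $G$. This changes no value on edge vectors, whose two ends have the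
  -- same least vertex.
  let c : (G.vertexSet →₀ ℤ) →ₗ[ℤ] ℤ :=
    Finsupp.lapply ((spanningGraph G S).connectedComponentMk x) ∘ₗ compMap G S
  let ψ : (G.vertexSet →₀ ℤ) →ₗ[ℤ] ℤ :=
    c - c ∘ₗ Finsupp.lmapDomain ℤ ℤ r ∘ₗ compMap G Finset.univ
  have hroot : rootSpan G ≤ LinearMap.ker ψ := by
    refine Submodule.span_le.2 ?_
    rintro _ ⟨F, z, hz, rfl⟩
    have hF : (spanningGraph G Finset.univ).connectedComponentMk z = F := hz.1
    have hz' : r ((spanningGraph G Finset.univ).connectedComponentMk z) = z := by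
      rw [hF]
      exact (hr F).unique hz
    rw [SetLike.mem_coe, LinearMap.mem_ker]
    simp [ψ, compMap_single, hz']
  have hψ : ∀ f, ψ (edgeVec G f) = c (edgeVec G f) := by
    intro f
    have h1 : edgeVec G f ∈ edgeSpan G Finset.univ := by
      rw [edgeSpan_eq_span]
      exact Submodule.subset_span ⟨f, by simp, rfl⟩
    rw [edgeSpan_eq_ker, LinearMap.mem_ker] at h1
    simp [ψ, h1]
  refine ⟨(rootSpan G).liftQ ψ hroot, ?_, fun f hf => ?_⟩
  · rw [Submodule.mkQ_apply, Submodule.liftQ_apply, hψ, hvec]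
    simp [c, compMap_single, hne]
  · rw [Submodule.mkQ_apply, Submodule.liftQ_apply, hψ]
    have h1 : edgeVec G f ∈ edgeSpan G S := by
      rw [edgeSpan_eq_span]
      exact Submodule.subset_span ⟨f, hf, rfl⟩
    rw [edgeSpan_eq_ker, LinearMap.mem_ker] at h1
    simp [c, h1]

/-- The characteristic cohomology of a graphic matroid vanishes in total degree below the rank. -/
theorem subsingleton_graphicCohomology [Finite G.vertexSet] [LinearOrder G.vertexSet]
    [Fintype G.edgeSet] [LinearOrder G.edgeSet] {i j : ℤ}
    (h : i + j < graphicRank G Finset.univ) : Subsingleton (graphicCohomology G i j) := by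
  refine subsingleton_cohomology (canonicalRep G)
    (v := fun e => (rootSpan G).mkQ (edgeVec G e)) (fun S => ?_)
    (fun S e he => exists_dual_of_graphicRank_ne G S e he) h
  change (edgeSpan G S).map (rootSpan G).mkQ = _
  rw [edgeSpan_eq_span, Submodule.map_span, Set.image_image]

end GraphicVanishing

end

end CharCoh

theorem corollary6p6 {α β : Type*} (G : Graph α β)
    [Finite G.vertexSet] [LinearOrder G.vertexSet]
    [Fintype G.edgeSet] [LinearOrder G.edgeSet]
    (n : ℕ) (hn : n + CharCoh.numConn G Finset.univ = Nat.card G.vertexSet + 1)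
    (i j : ℤ) (hij : i + j < (n : ℤ) - 1) :
    Nonempty (CharCoh.graphicCohomology G i j ≃ₗ[ℤ]
      CharCoh.graphicCohomology G (i + 1) (j - 1)) := by
  -- Together with `hn` this gives $n-1=\operatorname{rank}M(G)$, so both bidegrees lie in the
  -- vanishing range.
  have hrank := CharCoh.graphicRank_add_numConn G Finset.univ
  have h1 := CharCoh.subsingleton_graphicCohomology G (i := i) (j := j) (by omega)
  have h2 := CharCoh.subsingleton_graphicCohomology G (i := i + 1) (j := j - 1) (by omega)
  exact ⟨LinearEquiv.ofSubsingleton _ _⟩
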